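/- An exact $\infty$-category is an additive quasi-category $\mathcal C$ (it has a zero object, finite products and finite coproducts; for all $x,y$ the canonical map $x\sqcup y\to x\times y$ is an equivalence, and for all $x$ the shear map $\begin{pmatrix}\mathrm{id}&\mathrm{id}\\ *&\mathrm{id}\end{pmatrix}:x\oplus x\to x\oplus x$ is an equivalence) together with two subcategories $\mathcal M$ (cofibrations) and $\mathcal E$ (fibrations) of $\mathcal C$ such that: $\mathcal M$ and $\mathcal E$ contain all equivalences; morphisms of $\mathcal M$ admit pushouts along arbitrary morphisms and $\mathcal M$ is stable under pushouts; morphisms of $\mathcal E$ admit pullbacks along arbitrary morphisms and $\mathcal E$ is stable under pullbacks; and for every square with top edge $g:x\to y$, right edge $f:y\to z$ and lower left corner a zero object, if $g\in\mathcal M$ and the square is coCartesian then $f\in\mathcal E$ and the square is Cartesian, and if $f\in\mathcal E$ and the square is Cartesian then $g\in\mathcal M$ and the square is coCartesian. Let $T_2=\mathrm{Fun}([1],[2])$ be the poset of pairs $ij$ with $0\le i\le j\le 2$, ordered componentwise. For $n\ge 0$ let $S_2^{(n)}\mathcal C$ be the full subcategory of $\mathrm{Fun}(\mathrm N(T_2^n),\mathcal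 C)$ spanned by the diagrams $F$ such that 1. $F(i_1j_1,\dots,i_nj_n)$ is a zero object if $i_s=j_s$ for some $s$; 2. for every $s$ and all fixed values of the coordinates other than the $s$-th, the maps $F(\dots,aj,\dots)\to F(\dots,aj',\dots)$ with $a\le j\le j'$ in the $s$-th place are cofibrations; 3. for every $s$ and all fixed values of the coordinates other than the $s$-th, the maps $F(\dots,ia,\dots)\to F(\dots,i'a,\dots)$ with $i\le i'\le a$ in the $s$-th place are fibrations; 4. for every $r$, all $0\le a\le b\le 2$ and all fixed values of the coordinates other than the $r$-th, the square with upper row $F(\dots,0a,\dots)\to F(\dots,0b,\dots)$ and lower row $F(\dots,aa,\dots)\to F(\dots,ab,\dots)$ ($r$-th place) is coCartesian. (For $n=0$ this is $\mathcal C$, up to the canonical isomorphism.) For $n\ge 1$, $1\le l\le n$ and $0\le k\le 2$, the face functor $d_k(l):S_2^{(n)}\mathcal C\to S_2^{(n-1)}\mathcal C$ is the restriction along the map $T_2^{n-1}\to T_2^{n}$ that inserts $c_k$ in the $l$-th place, where $c_0=12$, $c_1=02$, $c_2=01$; that is, $$d_k(l)(F)(i_1j_1,\dots,i_{n-1}j_{n-1})=F(i_1j_1,\dots,i_{l-1}j_{l-1},\,c_k,\,i_lj_l,\dots,i_{n-1}j_{n-1}).$$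 **Proposition.** Let $\mathcal C$ be an exact $\infty$-category. For all integers $0\le p,k\le 2$ and $1\le l<q\le n$, the functors $$d_k(l)\circ d_p(q)\;\simeq\; d_p(q-1)\circ d_k(l)$$ are naturally equivalent in $\mathrm{Fun}(S_2^{(n)}\mathcal C,S_2^{(n-2)}\mathcal C)$, i.e. there is an edge between them in this $\infty$-category that is an equivalence. -/

import Mathlib

open CategoryTheory Simplicial Opposite MonoidalCategory

universe u

namespace ExactInfty

/-! ### Nerves of posets and the diagrams they index -/

/-- The nerve `N(P)` of a poset, in the universe of the ambient quasi-category. -/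
noncomputable def N (P : Type) [PartialOrder P] : SSet.{u} := nerve (ULift.{u} P)

/-- The map `N(P) ⟶ N(Q)` induced by a monotone map `P → Q`. -/
noncomputable def N.map {P Q : Type} [PartialOrder P] [PartialOrder Q] (f : P →o Q) :
    N.{u} P ⟶ N.{u} Q :=
  nerveMap (Monotone.functor (f := fun x : ULift.{u} P => ULift.up.{u} (f x.down))
    (fun _ _ h => f.monotone h))

theorem N.map_comp {P Q R : Type} [PartialOrder P] [PartialOrder Q] [PartialOrder R]
    (f : P →o Q) (g : Q →o R) : N.map.{u} f ≫ N.map g = N.map (g.comp f) := rfl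

/-- The vertex of `N(P)` given by an element of `P`. -/
noncomputable def N.pt {P : Type} [PartialOrder P] (a : P) : N.{u} P _⦋0⦌ :=
  nerveEquiv.symm (ULift.up a)

/-- The edge of `N(P)` given by a relation `a ≤ b`. -/
noncomputable def N.edge {P : Type} [PartialOrder P] {a b : P} (h : a ≤ b) :
    SSet.Edge (N.pt.{u} a) (N.pt.{u} b) :=
  nerve.edgeMk (homOfLE (show ULift.up.{u} a ≤ ULift.up.{u} b from h))

variable {C : SSet.{u}}

/-- The object `F(a)` of a diagram `F : N(P) ⟶ C`. -/
noncomputable def vtx {P : Type} [PartialOrder P] (F : N.{u} P ⟶ C) (a : P) : C _⦋0⦌ :=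
  F.app _ (N.pt a)

/-- The morphism `F(a) ⟶ F(b)` of a diagram `F : N(P) ⟶ C`, for `a ≤ b`. -/
noncomputable def arr {P : Type} [PartialOrder P] (F : N.{u} P ⟶ C) {a b : P} (h : a ≤ b) :
    SSet.Edge (vtx F a) (vtx F b) :=
  (N.edge h).map F

theorem vtx_map {P Q : Type} [PartialOrder P] [PartialOrder Q] (f : P →o Q) (F : N.{u} Q ⟶ C)
    (a : P) : vtx (N.map f ≫ F) a = vtx F (f a) := by
  have h : (N.map f).app _ (N.pt a) = N.pt.{u} (f a) := ComposableArrows.ext₀ rfl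
  exact congrArg (F.app _) h

theorem arr_map_edge {P Q : Type} [PartialOrder P] [PartialOrder Q] (f : P →o Q)
    (F : N.{u} Q ⟶ C) {a b : P} (h : a ≤ b) :
    (arr (N.map f ≫ F) h).edge = (arr F (f.monotone h)).edge := by
  have e : (N.map f).app _ (N.edge h).edge = (N.edge.{u} (f.monotone h)).edge :=
    ComposableArrows.ext₁ rfl rfl (Subsingleton.elim _ _)
  exact congrArg (F.app _) e

/-! ### Equivalences, initial, final and zero objects -/

/-- An edge is an equivalence if it has a two-sided inverse up to homotopy. -/
def IsEquivalence {X : SSet.{u}} {x y : X _⦋0⦌} (f : SSet.Edge x y) : Prop :=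
  Nonempty f.InvStruct

/-- `h` is a composite of `f` followed by `g`. -/
def IsComp {X : SSet.{u}} {x y z : X _⦋0⦌} (f : SSet.Edge x y) (g : SSet.Edge y z)
    (h : SSet.Edge x z) : Prop :=
  Nonempty (SSet.Edge.CompStruct f g h)

theorem vertex_mem_boundary (n : ℕ) (i : Fin (n + 2)) :
    SSet.stdSimplex.obj₀Equiv.symm i ∈
      (SSet.boundary.{u} (n + 1)).obj (op ⦋0⦌) := by
  intro h
  have := Fintype.card_le_of_surjective _ h
  simp at this

/-- The `i`-th vertex of `∂Δ[n + 1]`. -/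
def boundaryVertex (n : ℕ) (i : Fin (n + 2)) :
    ((SSet.boundary.{u} (n + 1) : (Δ[n + 1] : SSet.{u}).Subcomplex) : SSet.{u}) _⦋0⦌ :=
  ⟨SSet.stdSimplex.obj₀Equiv.symm i, vertex_mem_boundary n i⟩

/-- A vertex `x` is initial if every sphere `∂Δ[m] ⟶ X`, `m ≥ 1`, whose vertex `0` is `x`
can be filled. -/
def IsInitial {X : SSet.{u}} (x : X _⦋0⦌) : Prop :=
  ∀ (n : ℕ) (f : (SSet.boundary.{u} (n + 1) : SSet.{u}) ⟶ X),
    f.app _ (boundaryVertex n 0) = x →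
      ∃ g : Δ[n + 1] ⟶ X, (SSet.boundary.{u} (n + 1)).ι ≫ g = f

/-- A vertex `x` is final if every sphere `∂Δ[m] ⟶ X`, `m ≥ 1`, whose last vertex is `x`
can be filled. -/
def IsFinal {X : SSet.{u}} (x : X _⦋0⦌) : Prop :=
  ∀ (n : ℕ) (f : (SSet.boundary.{u} (n + 1) : SSet.{u}) ⟶ X),
    f.app _ (boundaryVertex n (Fin.last (n + 1))) = x →
      ∃ g : Δ[n + 1] ⟶ X, (SSet.boundary.{u} (n + 1)).ι ≫ g = f

/-- A zero object: both initial and final. -/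
def IsZeroObject {X : SSet.{u}} (x : X _⦋0⦌) : Prop := IsInitial x ∧ IsFinal x

/-! ### Slices, colimit cocones and limit cones over posets

The nerve of the ordinal sum `P ⊕ₗ Q` is the join `N(P) ⋆ N(Q)`. -/

/-- The inclusion of the first summand of an ordinal sum. -/
def inlHom (P Q : Type) [PartialOrder P] [PartialOrder Q] : P →o P ⊕ₗ Q :=
  ⟨fun a => Sum.inlₗ a, Sum.Lex.inl_mono⟩

/-- The inclusion of the second summand of an ordinal sum. -/
def inrHom (P Q : Type) [PartialOrder P] [PartialOrder Q] : Q →o P ⊕ₗ Q :=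
  ⟨fun a => Sum.inrₗ a, Sum.Lex.inr_mono⟩

/-- The ordinal sum of two monotone maps. -/
def lexMap {P P' Q Q' : Type} [PartialOrder P] [PartialOrder P'] [PartialOrder Q]
    [PartialOrder Q'] (f : P →o P') (g : Q →o Q') : P ⊕ₗ Q →o P' ⊕ₗ Q' where
  toFun x := toLex (Sum.map f g (ofLex x))
  monotone' := by
    intro x y h
    induction x using Lex.rec with | _ x
    induction y using Lex.rec with | _ y
    rcases x with x | x <;> rcases y with y | y
    · exact Sum.Lex.inl_le_inl_iff.2 (f.monotone (Sum.Lex.inl_le_inl_iff.1 h))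
    · exact Sum.Lex.inl_le_inr _ _
    · exact absurd h Sum.Lex.not_inr_le_inl
    · exact Sum.Lex.inr_le_inr_iff.2 (g.monotone (Sum.Lex.inr_le_inr_iff.1 h))

/-- The slice `C_{p/}`: its `n`-simplices are the maps `N(P) ⋆ Δ[n] ⟶ C` extending `p`. -/
noncomputable def sliceUnder {P : Type} [PartialOrder P] (p : N.{u} P ⟶ C) : SSet.{u} where
  obj Δ := {f : N.{u} (P ⊕ₗ Fin (Δ.unop.len + 1)) ⟶ C // N.map (inlHom P _) ≫ f = p}
  map θ := ↾fun f => ⟨N.map (lexMap OrderHom.id θ.unop.toOrderHom) ≫ f.1, f.2⟩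
  map_id Δ := by
    refine ConcreteCategory.hom_ext _ _ fun f => Subtype.ext ?_
    change N.map _ ≫ f.1 = f.1
    have : lexMap (OrderHom.id : P →o P) ((𝟙 Δ : Δ ⟶ Δ).unop.toOrderHom) = OrderHom.id := by
      ext x
      induction x using Lex.rec with | _ x
      rcases x with x | x <;> rfl
    rw [this]
    rfl
  map_comp θ η := by
    refine ConcreteCategory.hom_ext _ _ fun f => Subtype.ext ?_
    change N.map _ ≫ f.1 = N.map _ ≫ N.map _ ≫ f.1
    rw [← Category.assoc, N.map_comp]
    congr 2
    ext x
    induction x using Lex.rec with | _ x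
    rcases x with x | x <;> rfl

/-- The slice `C_{/p}`: its `n`-simplices are the maps `Δ[n] ⋆ N(P) ⟶ C` extending `p`. -/
noncomputable def sliceOver {P : Type} [PartialOrder P] (p : N.{u} P ⟶ C) : SSet.{u} where
  obj Δ := {f : N.{u} (Fin (Δ.unop.len + 1) ⊕ₗ P) ⟶ C // N.map (inrHom _ P) ≫ f = p}
  map θ := ↾fun f => ⟨N.map (lexMap θ.unop.toOrderHom OrderHom.id) ≫ f.1, f.2⟩
  map_id Δ := by
    refine ConcreteCategory.hom_ext _ _ fun f => Subtype.ext ?_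
    change N.map _ ≫ f.1 = f.1
    have : lexMap ((𝟙 Δ : Δ ⟶ Δ).unop.toOrderHom) (OrderHom.id : P →o P) = OrderHom.id := by
      ext x
      induction x using Lex.rec with | _ x
      rcases x with x | x <;> rfl
    rw [this]
    rfl
  map_comp θ η := by
    refine ConcreteCategory.hom_ext _ _ fun f => Subtype.ext ?_
    change N.map _ ≫ f.1 = N.map _ ≫ N.map _ ≫ f.1
    rw [← Category.assoc, N.map_comp]
    congr 2
    ext x
    induction x using Lex.rec with | _ x
    rcases x with x | x <;> rfl

/-- A cocone `N(P) ⋆ Δ[0] ⟶ C` is a colimit cocone if it is initial in the slice under its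
base. -/
def IsColimitCocone {P : Type} [PartialOrder P] (σ : N.{u} (P ⊕ₗ Fin 1) ⟶ C) : Prop :=
  IsInitial (X := sliceUnder (N.map (inlHom P (Fin 1)) ≫ σ)) ⟨σ, rfl⟩

/-- A cone `Δ[0] ⋆ N(P) ⟶ C` is a limit cone if it is final in the slice over its base. -/
def IsLimitCone {P : Type} [PartialOrder P] (σ : N.{u} (Fin 1 ⊕ₗ P) ⟶ C) : Prop :=
  IsFinal (X := sliceOver (N.map (inrHom (Fin 1) P) ≫ σ)) ⟨σ, rfl⟩

/-! ### Additive quasi-categories -/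

/-- The set `I` as a discrete poset. -/
def Discr (I : Type) : Type := I

instance (I : Type) : PartialOrder (Discr I) where
  le a b := a = b
  le_refl _ := rfl
  le_trans _ _ _ h h' := h.trans h'
  le_antisymm _ _ h _ := h

/-- The coprojection of index `i` in a cocone on a family. -/
noncomputable def coproj {I : Type} (σ : N.{u} (Discr I ⊕ₗ Fin 1) ⟶ C) (i : Discr I) :
    SSet.Edge (vtx σ (Sum.inlₗ i)) (vtx σ (Sum.inrₗ 0)) :=
  arr σ (Sum.Lex.inl_le_inr _ _)

/-- The projection of index `i` in a cone on a family. -/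
noncomputable def proj {I : Type} (τ : N.{u} (Fin 1 ⊕ₗ Discr I) ⟶ C) (i : Discr I) :
    SSet.Edge (vtx τ (Sum.inlₗ 0)) (vtx τ (Sum.inrₗ i)) :=
  arr τ (Sum.Lex.inl_le_inr _ _)

/-- A zero morphism: one that factors through a zero object. -/
def IsZeroEdge {X : SSet.{u}} {x y : X _⦋0⦌} (f : SSet.Edge x y) : Prop :=
  ∃ (z : X _⦋0⦌) (a : SSet.Edge x z) (b : SSet.Edge z y), IsZeroObject z ∧ IsComp a b f

/-- An edge that is the degenerate edge on its source. -/
def IsIdEdge {X : SSet.{u}} {x y : X _⦋0⦌} (f : SSet.Edge x y) : Prop :=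
  f.edge = (SSet.Edge.id x).edge

/-- `e` is the entry of `φ : ∐ xᵢ ⟶ ∏ yⱼ` from the summand `i` to the factor `j`: it is
a composite `xᵢ ⟶ ∐ xᵢ ⟶ ∏ yⱼ ⟶ yⱼ`. -/
def IsEntry {I J : Type} (σ : N.{u} (Discr I ⊕ₗ Fin 1) ⟶ C) (τ : N.{u} (Fin 1 ⊕ₗ Discr J) ⟶ C)
    (φ : SSet.Edge (vtx σ (Sum.inrₗ 0)) (vtx τ (Sum.inlₗ 0))) (i : Discr I) (j : Discr J)
    (e : SSet.Edge (vtx σ (Sum.inlₗ i)) (vtx τ (Sum.inrₗ j))) : Prop :=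
  ∃ a : SSet.Edge (vtx σ (Sum.inlₗ i)) (vtx τ (Sum.inlₗ 0)),
    IsComp (coproj σ i) φ a ∧ IsComp a (proj τ j) e

/-- The entry of `φ` from the summand `i` to the factor `j` is an identity. -/
def EntryId {I J : Type} (σ : N.{u} (Discr I ⊕ₗ Fin 1) ⟶ C) (τ : N.{u} (Fin 1 ⊕ₗ Discr J) ⟶ C)
    (φ : SSet.Edge (vtx σ (Sum.inrₗ 0)) (vtx τ (Sum.inlₗ 0))) (i : Discr I) (j : Discr J) :
    Prop :=
  ∃ e, IsEntry σ τ φ i j e ∧ IsIdEdge e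

/-- The entry of `φ` from the summand `i` to the factor `j` is zero. -/
def EntryZero {I J : Type} (σ : N.{u} (Discr I ⊕ₗ Fin 1) ⟶ C) (τ : N.{u} (Fin 1 ⊕ₗ Discr J) ⟶ C)
    (φ : SSet.Edge (vtx σ (Sum.inrₗ 0)) (vtx τ (Sum.inlₗ 0))) (i : Discr I) (j : Discr J) :
    Prop :=
  ∃ e, IsEntry σ τ φ i j e ∧ IsZeroEdge e

/-- Additive quasi-categories. In `shear`, both summands are the same object. -/
structure IsAdditive (C : SSet.{u}) : Prop where
  exists_zero : ∃ z : C _⦋0⦌, IsZeroObject z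
  coproducts : ∀ (n : ℕ) (p : N.{u} (Discr (Fin n)) ⟶ C),
    ∃ σ : N.{u} (Discr (Fin n) ⊕ₗ Fin 1) ⟶ C, N.map (inlHom _ _) ≫ σ = p ∧ IsColimitCocone σ
  products : ∀ (n : ℕ) (p : N.{u} (Discr (Fin n)) ⟶ C),
    ∃ τ : N.{u} (Fin 1 ⊕ₗ Discr (Fin n)) ⟶ C, N.map (inrHom _ _) ≫ τ = p ∧ IsLimitCone τ
  biproduct : ∀ (σ : N.{u} (Discr (Fin 2) ⊕ₗ Fin 1) ⟶ C) (τ : N.{u} (Fin 1 ⊕ₗ Discr (Fin 2)) ⟶ C),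
    N.map (inlHom _ _) ≫ σ = N.map (inrHom _ _) ≫ τ → IsColimitCocone σ → IsLimitCone τ →
    ∀ φ : SSet.Edge (vtx σ (Sum.inrₗ 0)) (vtx τ (Sum.inlₗ 0)),
      EntryId σ τ φ (0 : Fin 2) (0 : Fin 2) → EntryZero σ τ φ (1 : Fin 2) (0 : Fin 2) →
      EntryZero σ τ φ (0 : Fin 2) (1 : Fin 2) → EntryId σ τ φ (1 : Fin 2) (1 : Fin 2) →
      IsEquivalence φ
  shear : ∀ (σ : N.{u} (Discr (Fin 2) ⊕ₗ Fin 1) ⟶ C) (τ : N.{u} (Fin 1 ⊕ₗ Discr (Fin 2)) ⟶ C),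
    N.map (inlHom _ _) ≫ σ = N.map (inrHom _ _) ≫ τ → IsColimitCocone σ → IsLimitCone τ →
    vtx σ (Sum.inlₗ (0 : Fin 2)) = vtx σ (Sum.inlₗ (1 : Fin 2)) →
    ∀ φ : SSet.Edge (vtx σ (Sum.inrₗ 0)) (vtx τ (Sum.inlₗ 0)),
      EntryId σ τ φ (0 : Fin 2) (0 : Fin 2) → EntryId σ τ φ (1 : Fin 2) (0 : Fin 2) →
      EntryZero σ τ φ (0 : Fin 2) (1 : Fin 2) → EntryId σ τ φ (1 : Fin 2) (1 : Fin 2) →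
      IsEquivalence φ

/-! ### Squares -/

/-- The shape `(1,0) ← (0,0) → (0,1)` of a square without its last corner. -/
abbrev Span : Type := {x : Fin 2 × Fin 2 // x ≠ (1, 1)}

/-- The shape `(1,0) → (1,1) ← (0,1)` of a square without its first corner. -/
abbrev Cospan : Type := {x : Fin 2 × Fin 2 // x ≠ (0, 0)}

/-- The square as a cocone under a span. -/
def spanHom : Span ⊕ₗ Fin 1 →o Fin 2 × Fin 2 where
  toFun x := Sum.elim (fun s : Span => s.1) (fun _ => (1, 1)) (ofLex x)
  monotone' := by
    intro x y h
    induction x using Lex.rec with | _ x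
    induction y using Lex.rec with | _ y
    rcases x with x | x <;> rcases y with y | y
    · exact (Sum.Lex.inl_le_inl_iff.1 h : x ≤ y)
    · exact ⟨Fin.le_last _, Fin.le_last _⟩
    · exact absurd h Sum.Lex.not_inr_le_inl
    · exact le_rfl

/-- The square as a cone over a cospan. -/
def cospanHom : Fin 1 ⊕ₗ Cospan →o Fin 2 × Fin 2 where
  toFun x := Sum.elim (fun _ => (0, 0)) (fun s : Cospan => s.1) (ofLex x)
  monotone' := by
    intro x y h
    induction x using Lex.rec with | _ x
    induction y using Lex.rec with | _ y
    rcases x with x | x <;> rcases y with y | y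
    · exact le_rfl
    · exact ⟨Fin.zero_le _, Fin.zero_le _⟩
    · exact absurd h Sum.Lex.not_inr_le_inl
    · exact (Sum.Lex.inr_le_inr_iff.1 h : x ≤ y)

/-- A square in `C`: a map `Δ[1] × Δ[1] ⟶ C`. The horizontal edges are
`(0,0) → (0,1)` and `(1,0) → (1,1)`. -/
abbrev Square (C : SSet.{u}) := N.{u} (Fin 2 × Fin 2) ⟶ C

/-- CoCartesian squares. -/
def IsCocartesian (S : Square C) : Prop := IsColimitCocone (N.map spanHom ≫ S)

/-- Cartesian squares. -/
def IsCartesian (S : Square C) : Prop := IsLimitCone (N.map cospanHom ≫ S)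

/-- The edge `(0,0) → (0,1)` of a square. -/
noncomputable def Square.top (S : Square C) : SSet.Edge (vtx S (0, 0)) (vtx S (0, 1)) :=
  arr S (by decide)

/-- The edge `(1,0) → (1,1)` of a square. -/
noncomputable def Square.bottom (S : Square C) : SSet.Edge (vtx S (1, 0)) (vtx S (1, 1)) :=
  arr S (by decide)

/-- The edge `(0,1) → (1,1)` of a square. -/
noncomputable def Square.right (S : Square C) : SSet.Edge (vtx S (0, 1)) (vtx S (1, 1)) :=
  arr S (by decide)

/-! ### Exact quasi-categories -/

/-- A subcategory of `C` containing all objects, given by its class of morphisms. Closure under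
homotopy is the case of `comp_mem` in which one of the two composed edges is degenerate. -/
structure WideSubcategory (C : SSet.{u}) where
  mem : ∀ {x y : C _⦋0⦌}, SSet.Edge x y → Prop
  id_mem : ∀ x : C _⦋0⦌, mem (SSet.Edge.id x)
  comp_mem : ∀ {x y z : C _⦋0⦌} {f : SSet.Edge x y} {g : SSet.Edge y z} {h : SSet.Edge x z},
    IsComp f g h → mem f → mem g → mem h

theorem WideSubcategory.mem_of_edge_eq (W : WideSubcategory C) {x y x' y' : C _⦋0⦌}
    {f : SSet.Edge x y} {g : SSet.Edge x' y'} (h : f.edge = g.edge) (hf : W.mem f) :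
    W.mem g := by
  obtain rfl : x = x' := by rw [← f.src_eq, ← g.src_eq, h]
  obtain rfl : y = y' := by rw [← f.tgt_eq, ← g.tgt_eq, h]
  obtain rfl : f = g := SSet.Edge.ext h
  exact hf

/-- The structure of an exact ∞-category on a quasi-category `C`: `C` is additive and carries
subcategories of cofibrations and fibrations, which contain the equivalences, are stable under
pushouts resp. pullbacks (which exist), and have the same short exact sequences. -/
structure ExactStructure (C : SSet.{u}) [SSet.Quasicategory C] where
  additive : IsAdditive C
  cof : WideSubcategory C
  fib : WideSubcategory C
  cof_of_equivalence : ∀ {x y : C _⦋0⦌} (f : SSet.Edge x y), IsEquivalence f → cof.mem f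
  fib_of_equivalence : ∀ {x y : C _⦋0⦌} (f : SSet.Edge x y), IsEquivalence f → fib.mem f
  exists_pushout : ∀ p : N.{u} Span ⟶ C,
    cof.mem (arr p (a := ⟨(0, 0), by decide⟩) (b := ⟨(0, 1), by decide⟩) (by decide)) →
    ∃ S : Square C, N.map (inlHom Span (Fin 1)) ≫ N.map spanHom ≫ S = p ∧ IsCocartesian S
  cof_pushout : ∀ S : Square C, IsCocartesian S → cof.mem S.top → cof.mem S.bottom
  exists_pullback : ∀ p : N.{u} Cospan ⟶ C,
    fib.mem (arr p (a := ⟨(1, 0), by decide⟩) (b := ⟨(1, 1), by decide⟩) (by decide)) →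
    ∃ S : Square C, N.map (inrHom (Fin 1) Cospan) ≫ N.map cospanHom ≫ S = p ∧ IsCartesian S
  fib_pullback : ∀ S : Square C, IsCartesian S → fib.mem S.bottom → fib.mem S.top
  short_exact_of_cocartesian : ∀ S : Square C, IsZeroObject (vtx S (1, 0)) →
    cof.mem S.top → IsCocartesian S → fib.mem S.right ∧ IsCartesian S
  short_exact_of_cartesian : ∀ S : Square C, IsZeroObject (vtx S (1, 0)) →
    fib.mem S.right → IsCartesian S → cof.mem S.top ∧ IsCocartesian S

/-! ### Functor quasi-categories -/

/-- The map of simplicial sets given by a vertex of `Fun(K, C)`. -/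
noncomputable def toHom {K C : SSet.{u}} (x : ((ihom K).obj C) _⦋0⦌) : K ⟶ C :=
  CartesianMonoidalCategory.lift (𝟙 K) (SSet.const x) ≫ (ihom.ev K).app C

/-- The vertex of `Fun(K, C)` given by a map of simplicial sets. -/
noncomputable def ofHom {K C : SSet.{u}} (f : K ⟶ C) : ((ihom K).obj C) _⦋0⦌ :=
  (MonoidalClosed.curry (CartesianMonoidalCategory.fst K Δ[0] ≫ f)).app _
    (SSet.stdSimplex.obj₀Equiv.symm 0)

/-- `F` and `G` are naturally equivalent: they are joined by an equivalence in `Fun(X, Y)`. -/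
def NaturallyEquivalent {X Y : SSet.{u}} (F G : X ⟶ Y) : Prop :=
  ∃ η : SSet.Edge (X := (ihom X).obj Y) (ofHom F) (ofHom G), IsEquivalence η

/-- Precomposition `Fun(L, C) ⟶ Fun(K, C)` with a map `K ⟶ L`. -/
noncomputable def precomp {K L : SSet.{u}} (f : K ⟶ L) (C : SSet.{u}) :
    (ihom L).obj C ⟶ (ihom K).obj C :=
  (MonoidalClosed.pre f).app C

theorem const_comp {X Y Z : SSet.{u}} (y : Y _⦋0⦌) (f : Y ⟶ Z) :
    (SSet.const y : X ⟶ Y) ≫ f = SSet.const (f.app _ y) := by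
  simp

theorem toHom_precomp {K L : SSet.{u}} (f : K ⟶ L) (x : ((ihom L).obj C) _⦋0⦌) :
    toHom ((precomp f C).app _ x) = f ≫ toHom x := by
  have h := MonoidalClosed.id_tensor_pre_app_comp_ev f C
  unfold toHom precomp
  rw [← const_comp]
  have e : CartesianMonoidalCategory.lift (𝟙 K)
      ((SSet.const x : K ⟶ _) ≫ (MonoidalClosed.pre f).app C) =
      CartesianMonoidalCategory.lift (𝟙 K) (SSet.const x) ≫ K ◁ (MonoidalClosed.pre f).app C := by
    simp
  rw [e, Category.assoc, h]
  have e' : CartesianMonoidalCategory.lift (𝟙 K) (SSet.const x) ≫ f ▷ (ihom L).obj C =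
      f ≫ CartesianMonoidalCategory.lift (𝟙 L) (SSet.const x) := by
    simp
  rw [← Category.assoc, e', Category.assoc]

/-- The full simplicial subset spanned by the vertices with property `P`. -/
def fullSubcomplex (X : SSet.{u}) (P : X _⦋0⦌ → Prop) : X.Subcomplex where
  obj Δ := {s | ∀ i : ⦋0⦌ ⟶ Δ.unop, P (X.map i.op s)}
  map {Δ Δ'} θ s hs i := by
    have := hs (i ≫ θ.unop)
    simpa using this

/-! ### The construction `S_m^{(k)} C` -/

/-- The poset `T_m = Fun([1],[m])` of pairs `i ≤ j` in `{0, …, m}`, ordered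
componentwise. -/
abbrev T (m : ℕ) : Type := {x : Fin (m + 1) × Fin (m + 1) // x.1 ≤ x.2}

/-- The square in `T_m` with rows `0p → 0q` and `pp → pq`. -/
def squareT {m : ℕ} (p q : Fin (m + 1)) (h : p ≤ q) : Fin 2 × Fin 2 →o T m where
  toFun z := ⟨(if z.1 = 0 then 0 else p, if z.2 = 0 then p else q), by
    dsimp only
    split_ifs <;> simp [h]⟩
  monotone' := by
    rintro ⟨a, b⟩ ⟨a', b'⟩ ⟨h1, h2⟩
    have h1 : a ≤ a' := h1
    have h2 : b ≤ b' := h2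
    refine ⟨?_, ?_⟩
    · change (if a = 0 then 0 else p) ≤ (if a' = 0 then 0 else p)
      by_cases ha' : a' = 0
      · have ha : a = 0 := le_antisymm (ha' ▸ h1) (Fin.zero_le _)
        simp [ha, ha']
      · by_cases ha : a = 0 <;> simp [ha, ha']
    · change (if b = 0 then p else q) ≤ (if b' = 0 then p else q)
      by_cases hb' : b' = 0
      · have hb : b = 0 := le_antisymm (hb' ▸ h2) (Fin.zero_le _)
        simp [hb, hb']
      · by_cases hb : b = 0 <;> simp [hb, hb', h]

/-- The same square in the `r`-th coordinate of `T_m^k`, the other coordinates being those of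
`x`. -/
def squareTk {m k : ℕ} (x : Fin k → T m) (r : Fin k) (p q : Fin (m + 1)) (h : p ≤ q) :
    Fin 2 × Fin 2 →o (Fin k → T m) where
  toFun z := Function.update x r (squareT p q h z)
  monotone' _ _ hz := update_le_update_iff.2
    ⟨(squareT p q h).monotone hz, fun _ _ => le_rfl⟩

/-- The conditions on a diagram `F : N(T_m^k) ⟶ C` that define the objects of `S_m^{(k)} C`. In `horizontal` (resp. `vertical`) only the `s`-th coordinate varies, along
`aj ≤ aj'` (resp. `ia ≤ i'a`). -/
structure IsSDiagram [SSet.Quasicategory C] (X : ExactStructure C) {m k : ℕ}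
    (F : N.{u} (Fin k → T m) ⟶ C) : Prop where
  zero : ∀ (x : Fin k → T m) (l : Fin k), (x l).1.1 = (x l).1.2 → IsZeroObject (vtx F x)
  horizontal : ∀ (s : Fin k) (x y : Fin k → T m) (h : x ≤ y), (∀ r, r ≠ s → x r = y r) →
    (x s).1.1 = (y s).1.1 → X.cof.mem (arr F h)
  vertical : ∀ (s : Fin k) (x y : Fin k → T m) (h : x ≤ y), (∀ r, r ≠ s → x r = y r) →
    (x s).1.2 = (y s).1.2 → X.fib.mem (arr F h)
  cocartesian : ∀ (x : Fin k → T m) (r : Fin k) (p q : Fin (m + 1)) (h : p ≤ q),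
    IsCocartesian (N.map (squareTk x r p q h) ≫ F)

/-- `S_m^{(k)} C`, the full subcategory of `Fun(N(T_m^k), C)` spanned by the diagrams with
the property `IsSDiagram`. -/
noncomputable def S [SSet.Quasicategory C] (X : ExactStructure C) (m k : ℕ) :
    ((ihom (N.{u} (Fin k → T m))).obj C).Subcomplex :=
  fullSubcomplex _ (fun x => IsSDiagram X (toHom x))

/-! ### Face functors -/

/-- The element `12`, `02`, `01` of `T_2` for `k = 0, 1, 2`. -/
def faceElt (k : Fin 3) : T 2 :=
  match k with
  | 0 => ⟨(1, 2), by decide⟩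
  | 1 => ⟨(0, 2), by decide⟩
  | 2 => ⟨(0, 1), by decide⟩

/-- The map `T_m^n → T_m^{n+1}` inserting the element `c` in the place `l` (numbered from
zero). -/
def insertHom {m n : ℕ} (l : Fin (n + 1)) (c : T m) : (Fin n → T m) →o (Fin (n + 1) → T m) where
  toFun x := Fin.insertNth (α := fun _ => T m) l c x
  monotone' x y h := by
    rw [Fin.insertNth_le_iff]
    refine ⟨by simp, fun j => by simpa using h j⟩

theorem insertHom_self {m n : ℕ} (l : Fin (n + 1)) (c : T m) (x : Fin n → T m) :
    insertHom l c x l = c :=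
  Fin.insertNth_apply_same (α := fun _ => T m) l c x

theorem insertHom_succAbove {m n : ℕ} (l : Fin (n + 1)) (c : T m) (x : Fin n → T m)
    (i : Fin n) : insertHom l c x (l.succAbove i) = x i :=
  Fin.insertNth_apply_succAbove (α := fun _ => T m) l c x i

theorem insertHom_eq {m n : ℕ} (l : Fin (n + 1)) (c : T m) {x y : Fin n → T m} {s : Fin n}
    (h : ∀ r, r ≠ s → x r = y r) (r : Fin (n + 1)) (hr : r ≠ l.succAbove s) :
    insertHom l c x r = insertHom l c y r := by
  rcases Fin.eq_self_or_eq_succAbove l r with rfl | ⟨j, rfl⟩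
  · rw [insertHom_self, insertHom_self]
  · rw [insertHom_succAbove, insertHom_succAbove]
    exact h j (fun e => hr (by rw [e]))

theorem insertHom_comp_squareTk {m n : ℕ} (l : Fin (n + 1)) (c : T m) (x : Fin n → T m)
    (r : Fin n) (p q : Fin (m + 1)) (h : p ≤ q) :
    (insertHom l c).comp (squareTk x r p q h) =
      squareTk (insertHom l c x) (l.succAbove r) p q h := by
  apply OrderHom.ext
  funext z i
  change insertHom l c (Function.update x r (squareT p q h z)) i =
    Function.update (insertHom l c x) (l.succAbove r) (squareT p q h z) i
  rcases Fin.eq_self_or_eq_succAbove l i with rfl | ⟨j, rfl⟩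
  · rw [insertHom_self, Function.update_of_ne (Fin.succAbove_ne i r).symm, insertHom_self]
  · rw [insertHom_succAbove]
    by_cases hj : j = r
    · subst hj
      simp
    · rw [Function.update_of_ne hj,
        Function.update_of_ne (fun e => hj (Fin.succAbove_right_injective e)),
        insertHom_succAbove]

theorem IsSDiagram.insert [SSet.Quasicategory C] {X : ExactStructure C} {m n : ℕ}
    {F : N.{u} (Fin (n + 1) → T m) ⟶ C} (hF : IsSDiagram X F) (l : Fin (n + 1)) (c : T m) :
    IsSDiagram X (N.map (insertHom l c) ≫ F) where
  zero x i hi := by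
    rw [vtx_map]
    exact hF.zero _ (l.succAbove i) (by rw [insertHom_succAbove]; exact hi)
  horizontal s x y h hr hs := by
    refine X.cof.mem_of_edge_eq (arr_map_edge (insertHom l c) F h).symm
      (hF.horizontal (l.succAbove s) _ _ _ (insertHom_eq l c hr) ?_)
    rw [insertHom_succAbove, insertHom_succAbove]
    exact hs
  vertical s x y h hr hs := by
    refine X.fib.mem_of_edge_eq (arr_map_edge (insertHom l c) F h).symm
      (hF.vertical (l.succAbove s) _ _ _ (insertHom_eq l c hr) ?_)
    rw [insertHom_succAbove, insertHom_succAbove]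
    exact hs
  cocartesian x r p q h := by
    rw [← Category.assoc, N.map_comp, insertHom_comp_squareTk]
    exact hF.cocartesian _ _ _ _ _

/-- The face functor `d_k(l) : S_2^{(n+1)} C ⟶ S_2^{(n)} C`, for `1 ≤ l ≤ n + 1` and
`0 ≤ k ≤ 2`: precomposition with the map inserting `12`, `02` or `01` in the `l`-th place. -/
noncomputable def face [SSet.Quasicategory C] (X : ExactStructure C) {n : ℕ} (k : Fin 3) (l : ℕ)
    (h1 : 1 ≤ l) (h2 : l ≤ n + 1) : (S X 2 (n + 1) : SSet.{u}) ⟶ (S X 2 n : SSet.{u}) :=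
  SSet.Subcomplex.lift
    ((S X 2 (n + 1)).ι ≫ precomp (N.map (insertHom ⟨l - 1, by omega⟩ (faceElt k))) C)
    (by
      rintro Δ _ ⟨s, rfl⟩ i
      have h : IsSDiagram X (toHom ((precomp (N.map.{u} (insertHom ⟨l - 1, by omega⟩
          (faceElt k))) C).app _ (((ihom (N.{u} (Fin (n + 1) → T 2))).obj C).map i.op s.1))) := by
        rw [toHom_precomp]
        exact (s.2 i).insert _ _
      rw [NatTrans.naturality_apply] at h
      exact h)

end ExactInfty

namespace ExactInfty

/-! Each face functor is restriction of diagrams along a map of posets that inserts a fixed element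
of `T 2` in one place. Restriction is strictly contravariant in the poset map, so both composites
restrict a diagram on `T_2^(n+2)` along a map `T_2^n → T_2^(n+2)` that puts `faceElt k` in place `l`
and `faceElt p` in place `q`, leaving the remaining coordinates in their order. The only difference
is which insertion is made first: with the element in place `l` absent, the later place `q` is
numbered `q - 1`. The two poset maps are equal (`insertHom_comp_insertHom`), hence so are the two
functors (`face_comp_face`), and the required equivalence is the identity edge
(`NaturallyEquivalent.of_eq`). The exact structure plays no part in this comparison. It matters only
for restriction to preserve the defining conditions of `S`, which is already built into `face`. -/

/-- Insertions in two different places commute. -/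
theorem insertHom_comp_insertHom {m n : ℕ} (i j : ℕ) (hij : i ≤ j) (hj : j < n + 1)
    (a b : T m) :
    (insertHom (⟨j + 1, by omega⟩ : Fin (n + 2)) b).comp
        (insertHom (⟨i, by omega⟩ : Fin (n + 1)) a) =
      (insertHom (⟨i, by omega⟩ : Fin (n + 2)) a).comp
        (insertHom (⟨j, hj⟩ : Fin (n + 1)) b) := by
  apply OrderHom.ext
  funext x
  change insertHom (⟨j + 1, _⟩ : Fin (n + 2)) b (insertHom ⟨i, _⟩ a x) =
    insertHom (⟨i, _⟩ : Fin (n + 2)) a (insertHom ⟨j, hj⟩ b x)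
  -- Skipping place `j + 1` leaves the index `i` unchanged because `i < j + 1`, whereas skipping
  -- place `i` shifts `j` to `j + 1` because `i ≤ j`. This asymmetry is the source of the `q - 1` in
  -- the face identity.
  have hlt : (⟨i, by omega⟩ : Fin (n + 2)) =
      (⟨j + 1, by omega⟩ : Fin (n + 2)).succAbove ⟨i, by omega⟩ := by
    rw [Fin.succAbove_of_castSucc_lt _ _ (by simp [Fin.lt_def]; omega)]; rfl
  have hgt : (⟨j + 1, by omega⟩ : Fin (n + 2)) =
      (⟨i, by omega⟩ : Fin (n + 2)).succAbove ⟨j, hj⟩ := by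
    rw [Fin.succAbove_of_le_castSucc _ _ (by simpa [Fin.le_def] using hij)]; rfl
  funext r
  -- A coordinate is place `i` (value `a` on both sides), place `j + 1` (value `b`), or one
  -- inherited from `x`.
  rcases Fin.eq_self_or_eq_succAbove (⟨i, by omega⟩ : Fin (n + 2)) r with rfl | ⟨s, rfl⟩
  · rw [insertHom_self, hlt, insertHom_succAbove, insertHom_self]
  · rw [insertHom_succAbove]
    rcases Fin.eq_self_or_eq_succAbove (⟨j, hj⟩ : Fin (n + 1)) s with rfl | ⟨t, rfl⟩
    · rw [insertHom_self, ← hgt, insertHom_self]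
    -- The cosimplicial identity for coface maps: both sides enumerate, in increasing order, the
    -- places other than `i` and `j + 1`.
    · have e : (⟨i, by omega⟩ : Fin (n + 2)).succAbove ((⟨j, hj⟩ : Fin (n + 1)).succAbove t) =
          (⟨j + 1, by omega⟩ : Fin (n + 2)).succAbove
            ((⟨i, by omega⟩ : Fin (n + 1)).succAbove t) := by
        obtain ⟨t, ht⟩ := t
        apply Fin.ext
        simp only [Fin.succAbove, Fin.lt_def, apply_ite Fin.val, Fin.val_castSucc, Fin.val_succ]
        split_ifs <;> omega
      rw [insertHom_succAbove, e, insertHom_succAbove, insertHom_succAbove]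

theorem precomp_comp {K L M : SSet.{u}} (f : K ⟶ L) (g : L ⟶ M) (C : SSet.{u}) :
    precomp g C ≫ precomp f C = precomp (f ≫ g) C := by
  simp [precomp, MonoidalClosed.pre_map]

/-- The identity edge is an equivalence. -/
theorem isEquivalence_id {X : SSet.{u}} (x : X _⦋0⦌) : IsEquivalence (SSet.Edge.id x) :=
  ⟨SSet.Edge.InvStruct.invStructId x⟩

/-- Equal maps define the same vertex of `Fun(X, Y)`, and the degenerate edge there is its own
inverse. -/
theorem NaturallyEquivalent.of_eq {X Y : SSet.{u}} {F G : X ⟶ Y} (h : F = G) :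
    NaturallyEquivalent F G := by
  subst h
  exact ⟨SSet.Edge.id _, isEquivalence_id _⟩

/-- Reduces identities between face functors to identities between restrictions on the whole functor
category, where the conditions defining `S` no longer appear. -/
theorem face_comp_ι {C : SSet.{u}} [SSet.Quasicategory C] (X : ExactStructure C) {n : ℕ}
    (k : Fin 3) (l : ℕ) (h1 : 1 ≤ l) (h2 : l ≤ n + 1) :
    face X k l h1 h2 ≫ (S X 2 n).ι =
      (S X 2 (n + 1)).ι ≫ precomp (N.map (insertHom ⟨l - 1, by omega⟩ (faceElt k))) C :=
  SSet.Subcomplex.lift_ι _ _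

/-- Face functors in different directions commute strictly. -/
theorem face_comp_face {C : SSet.{u}} [SSet.Quasicategory C] (X : ExactStructure C)
    {n : ℕ} (k p : Fin 3) {l q : ℕ} (hlq : l < q) (hq : 1 ≤ q) (hq' : q ≤ n + 2)
    (hl : 1 ≤ l) (hl' : l ≤ n + 1) (hl'' : l ≤ n + 2) (hp : 1 ≤ q - 1) (hp' : q - 1 ≤ n + 1) :
    face X (n := n + 1) p q hq hq' ≫ face X (n := n) k l hl hl' =
      face X (n := n + 1) k l hl hl'' ≫ face X (n := n) p (q - 1) hp hp' := by
  -- Places are counted from one in `face` and from zero in `insertHom`: `l`, `q` and `q - 1` become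
  -- `i`, `j + 1` and `j`, and `l < q` becomes `i ≤ j`. In this form the truncated subtractions
  -- reduce by computation.
  obtain ⟨i, rfl⟩ : ∃ i, l = i + 1 := ⟨l - 1, by omega⟩
  obtain ⟨j, rfl⟩ : ∃ j, q = j + 2 := ⟨q - 2, by omega⟩
  -- The inclusion of the full subcategory is a monomorphism, so the comparison may be made in the
  -- ambient functor category.
  rw [← cancel_mono (S X 2 n).ι]
  simp only [Category.assoc, face_comp_ι]
  rw [← Category.assoc, ← Category.assoc, face_comp_ι, face_comp_ι, Category.assoc,
    Category.assoc, precomp_comp, precomp_comp, N.map_comp, N.map_comp]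
  exact congrArg (fun f => (S X 2 (n + 2)).ι ≫ precomp (N.map f) C)
    (insertHom_comp_insertHom i j (by omega) (by omega) (faceElt k) (faceElt p))

end ExactInfty

/-- The diagrams have `n + 2` directions since `1 ≤ l < q` forces at least two. The operator `≫`
composes in diagrammatic order, so `d_k(l) ∘ d_p(q)` has `face X p q` on the left. -/
theorem mainTheorem6 {C : SSet.{u}} [SSet.Quasicategory C] (X : ExactInfty.ExactStructure C)
    (n : ℕ) (k p : Fin 3) (l q : ℕ) (hl : 1 ≤ l) (hlq : l < q) (hq : q ≤ n + 2) :
    ExactInfty.NaturallyEquivalent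
      (X := (ExactInfty.S X 2 (n + 2) : SSet.{u})) (Y := (ExactInfty.S X 2 n : SSet.{u}))
      (ExactInfty.face X p q (by omega) (by omega) ≫ ExactInfty.face X k l (by omega) (by omega))
      (ExactInfty.face X k l (by omega) (by omega) ≫
        ExactInfty.face X p (q - 1) (by omega) (by omega)) := by
  exact ExactInfty.NaturallyEquivalent.of_eq (ExactInfty.face_comp_face X k p hlq _ _ _ _ _ _ _)
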